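/- Let $\mathfrak S_n$ be the set of permutations $\pi=\pi(1)\pi(2)\cdots\pi(n)$ of $\{1,\dots,n\}$. - $\pi$ *changes direction* at $i\in\{2,\dots,n-1\}$ if $\pi(i-1)<\pi(i)>\pi(i+1)$ or $\pi(i-1)>\pi(i)<\pi(i+1)$. For $n\ge 2$, $\pi$ has $k$ *alternating runs* if it changes direction at exactly $k-1$ positions. For $n\ge 2$ let $R_n(x)=\sum_{k=1}^{n-1}R(n,k)x^k$, where $R(n,k)$ is the number of $\pi\in\mathfrak S_n$ with $k$ alternating runs. - An *alternating subsequence* of length $k$ of $\pi$ is a subsequence with $\pi(i_1)>\pi(i_2)<\pi(i_3)>\cdots\,\pi(i_k)$, $i_1<i_2<\cdots<i_k$ (any single letter is one, of length $1$). Let $a_k(n)$ be the number of $\pi\in\mathfrak S_n$ whose longest alternating subsequence has length $k$; put $T_n(x)=\sum_{k=1}^n a_k(n)x^k$ for $n\ge 1$ and $T_0(x)=1$. - An *interior peak* of $\pi$ is an index $i\in\{2,\dots,n-1\}$ with $\pi(i-1)<\pi(i)>\pi(i+1)$. A *left peak* is an index $i\in\{1,\dots,n-1\}$ with $\pi(i-1)<\pi(i)>\pi(i+1)$,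 where $\pi(0)=0$. Let $W_n(x)=\sum_{k\ge0}W(n,k)x^k$ and $\widetilde W_n(x)=\sum_{k\ge0}\widetilde W(n,k)x^k$ for $n\ge1$, where $W(n,k)$ and $\widetilde W(n,k)$ are the numbers of $\pi\in\mathfrak S_n$ with $k$ interior peaks and with $k$ left peaks, respectively; put $\widetilde W_0(x)=1$. Then for every $n\ge 1$ the following identities between polynomials hold: $$R_{n+1}(x)=\sum_{k=0}^n\binom nk T_k(x)T_{n-k}(x),$$ $$R_{n+2}(x)=2\sum_{k=0}^n\binom nk T_k(x)T_{n-k+1}(x),$$ $$R_{n+2}(x)=2x\,\widetilde W_n(x^2)+2x\sum_{k=1}^n\binom nk R_{k+1}(x)\,\widetilde W_{n-k}(x^2),$$ $$T_{n+1}(x)=x\sum_{k=0}^n\binom nk T_k(x)\,\widetilde W_{n-k}(x^2),$$ $$T_{n+1}(x)=T_n(x)+x^2\sum_{k=0}^{n-1}\binom nk T_k(x)\,W_{n-k}(x^2).$$ -/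

import Mathlib

open Polynomial

namespace PermPoly

/-- The word `π(1) π(2) ⋯ π(n)` of a permutation of `{1, …, n}`, indexed from `1`, with values in
`{1, …, n}`. Mathlib's `Equiv.Perm (Fin n)` acts on `{0, …, n - 1}`, hence the shift by one.
The word takes the value `0` outside the positions `1, …, n`; in particular `π(0) = 0`. -/
def word {n : ℕ} (π : Equiv.Perm (Fin n)) (i : ℕ) : ℕ :=
  if h : 1 ≤ i ∧ i ≤ n then (π ⟨i - 1, by omega⟩ : ℕ) + 1 else 0

/-- `π(i - 1) < π(i) > π(i + 1)`. -/
def PeakAt {n : ℕ} (π : Equiv.Perm (Fin n)) (i : ℕ) : Prop :=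
  word π (i - 1) < word π i ∧ word π i > word π (i + 1)

/-- `π(i - 1) > π(i) < π(i + 1)`. -/
def ValleyAt {n : ℕ} (π : Equiv.Perm (Fin n)) (i : ℕ) : Prop :=
  word π (i - 1) > word π i ∧ word π i < word π (i + 1)

instance {n : ℕ} (π : Equiv.Perm (Fin n)) : DecidablePred (PeakAt π) :=
  fun _ => inferInstanceAs (Decidable (_ ∧ _))

instance {n : ℕ} (π : Equiv.Perm (Fin n)) : DecidablePred (ValleyAt π) :=
  fun _ => inferInstanceAs (Decidable (_ ∧ _))

/-- The number of positions `i ∈ {2, …, n - 1}` at which `π` changes direction. -/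
def numChanges {n : ℕ} (π : Equiv.Perm (Fin n)) : ℕ :=
  ((Finset.Icc 2 (n - 1)).filter (fun i => PeakAt π i ∨ ValleyAt π i)).card

/-- The number of alternating runs of `π`: one more than the number of changes of direction, where a
word with at most one letter has no run. -/
def numRuns {n : ℕ} (π : Equiv.Perm (Fin n)) : ℕ :=
  if n ≤ 1 then 0 else numChanges π + 1

/-- The number of interior peaks of `π`. -/
def numInteriorPeaks {n : ℕ} (π : Equiv.Perm (Fin n)) : ℕ :=
  ((Finset.Icc 2 (n - 1)).filter (fun i => PeakAt π i)).card

/-- The number of left peaks of `π` (position `1` is allowed, with `π(0) = 0`). -/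
def numLeftPeaks {n : ℕ} (π : Equiv.Perm (Fin n)) : ℕ :=
  ((Finset.Icc 1 (n - 1)).filter (fun i => PeakAt π i)).card

/-- The positions `i 0 < i 1 < ⋯ < i (k - 1)` pick out an alternating subsequence of `π`, that is,
`π(i 0) > π(i 1) < π(i 2) > ⋯`. -/
def IsAlternatingSubsequence {n k : ℕ} (π : Equiv.Perm (Fin n)) (i : Fin k → Fin n) : Prop :=
  StrictMono i ∧ ∀ (j : ℕ) (hj : j + 1 < k),
    if Even j then π (i ⟨j, by omega⟩) > π (i ⟨j + 1, hj⟩)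
    else π (i ⟨j, by omega⟩) < π (i ⟨j + 1, hj⟩)

/-- The set of lengths of alternating subsequences is bounded, so that its supremum is a maximum. -/
theorem bddAbove_alternating {n : ℕ} (π : Equiv.Perm (Fin n)) :
    BddAbove {k : ℕ | ∃ i : Fin k → Fin n, IsAlternatingSubsequence π i} := by
  refine ⟨n, ?_⟩
  rintro k ⟨i, hi, -⟩
  simpa using Fintype.card_le_of_injective i hi.injective

/-- The length of the longest alternating subsequence of `π`. -/
noncomputable def longestAlternating {n : ℕ} (π : Equiv.Perm (Fin n)) : ℕ :=
  sSup {k : ℕ | ∃ i : Fin k → Fin n, IsAlternatingSubsequence π i}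

/-- The number of permutations of `{1, …, n}` at which the statistic `stat` equals `k`. -/
def countStat {n : ℕ} (stat : Equiv.Perm (Fin n) → ℕ) (k : ℕ) : ℕ :=
  (Finset.univ.filter (fun π => stat π = k)).card

/-- `R(n, k)`: permutations with `k` alternating runs. -/
def numR (n k : ℕ) : ℕ := countStat (n := n) numRuns k

/-- `a_k(n)`: permutations whose longest alternating subsequence has length `k`. -/
noncomputable def numA (k n : ℕ) : ℕ := countStat (n := n) longestAlternating k

/-- `W(n, k)`: permutations with `k` interior peaks. -/
def numW (n k : ℕ) : ℕ := countStat (n := n) numInteriorPeaks k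

/-- `W̃(n, k)`: permutations with `k` left peaks. -/
def numWTilde (n k : ℕ) : ℕ := countStat (n := n) numLeftPeaks k

/-- `R_n(x) = ∑_{k=1}^{n-1} R(n, k) x^k` for `n ≥ 2`, and `R_1(x) = 1`. The summation starts at
`k = 0`, where `R(n, 0) = 0` for `n ≥ 2` and `R(1, 0) = 1`. -/
noncomputable def R (n : ℕ) : ℤ[X] :=
  ∑ k ∈ Finset.range n, (numR n k : ℤ[X]) * X ^ k

/-- `T_n(x) = ∑_{k=1}^n a_k(n) x^k` for `n ≥ 1`, and `T_0(x) = 1`. The summation starts at `k = 0`,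
where `a_0(n) = 0` for `n ≥ 1` and `a_0(0) = 1`. -/
noncomputable def T (n : ℕ) : ℤ[X] :=
  ∑ k ∈ Finset.range (n + 1), (numA k n : ℤ[X]) * X ^ k

/-- `W_n(x) = ∑_{k ≥ 0} W(n, k) x^k`; a permutation of `{1, …, n}` has at most `n` peaks. -/
noncomputable def W (n : ℕ) : ℤ[X] :=
  ∑ k ∈ Finset.range (n + 1), (numW n k : ℤ[X]) * X ^ k

/-- `W̃_n(x) = ∑_{k ≥ 0} W̃(n, k) x^k`; a permutation of `{1, …, n}` has at most `n` peaks. -/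
noncomputable def WTilde (n : ℕ) : ℤ[X] :=
  ∑ k ∈ Finset.range (n + 1), (numWTilde n k : ℤ[X]) * X ^ k

end PermPoly

namespace PermPoly

/-! Every statistic is read off the word of ascents and descents of `π`. Alternating runs are its
maximal constant blocks. The longest alternating subsequence counts the blocks once an ascent is put
in front, as if `π(0) = 0` (`longestAlternating_eq`). Peaks are ascents followed by descents.

Cut `π = σ m τ` at the greatest or the least letter `m`. The direction switches at `m`, so block
counts of the two sides add, and the choice of the letters of `σ` gives a binomial convolution
(`sum_perm_split`). At the maximum both sides are distributed as `T`, which gives `R_succ`. With `0`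
in front, the left side starts and ends with an ascent, so it has `1 + 2 * peaks` blocks, which
gives `T_succ`. At the minimum, a nonempty `σ` contributes `2 + 2 * valleys` blocks, which gives
`T_succ_eq_conv_leftOfMin`.

In terms of exponential generating functions, `R' = T²` and `T' = x T W̃(x²)`. The two formulas for
`R (n + 2)` are then `R'' = 2 T T'` and `R'' = 2x R' W̃(x²)`, using that `conv` is commutative and
associative and that the index shift is a derivation (`conv_succ`). -/

/-! ### Direction words -/

/-- The number of adjacent pairs of `d :: l` that satisfy `P`. -/
def adj (P : Bool → Bool → Bool) : Bool → List Bool → ℕ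
  | _, [] => 0
  | d, b :: l => (if P d b then 1 else 0) + adj P b l

/-- The number of adjacent pairs that satisfy `P`. -/
def pairs (P : Bool → Bool → Bool) : List Bool → ℕ
  | [] => 0
  | d :: l => adj P d l

/-- The number of maximal constant blocks of a list. -/
def blocks : List Bool → ℕ
  | [] => 0
  | d :: l => 1 + adj xor d l

/-- An ascent followed by a descent. -/
def isPeak (a b : Bool) : Bool := a && !b

variable {α β : Type*} [LinearOrder α] [LinearOrder β]

/-- The directions (`true` for an ascent) between consecutive letters of `a :: l`. -/
def dirsFrom : α → List α → List Bool
  | _, [] => []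
  | a, b :: l => decide (a < b) :: dirsFrom b l

/-- The directions between consecutive letters of a word. -/
def dirs : List α → List Bool
  | [] => []
  | a :: l => dirsFrom a l

/-- The directions of a nonempty word, preceded by `d`. -/
def lead (d : Bool) : List α → List Bool
  | [] => []
  | a :: l => d :: dirsFrom a l

/-- The directions of a nonempty word, followed by `d`. -/
def trail (d : Bool) : List α → List Bool
  | [] => []
  | a :: l => dirsFrom a l ++ [d]

theorem dirsFrom_map {f : α → β} (hf : StrictMono f) (a : α) (l : List α) :
    dirsFrom (f a) (l.map f) = dirsFrom a l := by
  induction l generalizing a with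
  | nil => rfl
  | cons b l ih => simp [dirsFrom, ih, hf.lt_iff_lt]

theorem dirs_map {f : α → β} (hf : StrictMono f) (l : List α) : dirs (l.map f) = dirs l := by
  cases l with
  | nil => rfl
  | cons a l => exact dirsFrom_map hf a l

theorem lead_map {f : α → β} (hf : StrictMono f) (d : Bool) (l : List α) :
    lead d (l.map f) = lead d l := by
  cases l with
  | nil => rfl
  | cons a l => simp [lead, dirsFrom_map hf a l]

theorem trail_map {f : α → β} (hf : StrictMono f) (d : Bool) (l : List α) :
    trail d (l.map f) = trail d l := by
  cases l with
  | nil => rfl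
  | cons a l => simp [trail, dirsFrom_map hf a l]

/-! ### Runs and peaks read off the direction word -/

theorem adj_dirsFrom_eq_card (P : Bool → Bool → Bool) (w : ℕ → ℕ) (s n : ℕ) :
    adj P (decide (w s < w (s + 1))) (dirsFrom (w (s + 1)) ((List.range' (s + 2) n).map w)) =
      ((Finset.Icc (s + 1) (s + n)).filter
        (fun i => P (decide (w (i - 1) < w i)) (decide (w i < w (i + 1))) = true)).card := by
  induction n generalizing s with
  | zero => simp [dirsFrom, adj]
  | succ n ih =>
    have h : Finset.Icc (s + 1) (s + (n + 1)) = insert (s + 1) (Finset.Icc (s + 1 + 1) (s + 1 + n)) := by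
      ext i; simp only [Finset.mem_Icc, Finset.mem_insert]; omega
    rw [h, Finset.filter_insert, List.range'_succ, List.map_cons, dirsFrom, adj, ih (s + 1)]
    simp only [Nat.add_sub_cancel]
    split_ifs
    · rw [Finset.card_insert_of_notMem (by simp), add_comm]
    · simp

/-- The one-line notation of a permutation. -/
def oneLine {n : ℕ} (π : Equiv.Perm (Fin n)) : List (Fin n) := List.ofFn π

theorem map_oneLine {n : ℕ} (π : Equiv.Perm (Fin n)) :
    (oneLine π).map (fun x : Fin n => (x : ℕ) + 1) = (List.range' 1 n).map (word π) := by
  apply List.ext_getElem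
  · simp [oneLine]
  · intro i h₁ h₂
    have hi : i < n := by simpa [oneLine] using h₁
    have : 1 + i ≤ n := by omega
    simp [oneLine, word, this]

theorem strictMono_succ_val (n : ℕ) : StrictMono (fun x : Fin n => (x : ℕ) + 1) := by
  intro a b h
  simpa using h

theorem dirs_oneLine {n : ℕ} (π : Equiv.Perm (Fin n)) :
    dirs (oneLine π) = dirs ((List.range' 1 n).map (word π)) := by
  rw [← map_oneLine, dirs_map (strictMono_succ_val n)]

theorem lead_oneLine {n : ℕ} (d : Bool) (π : Equiv.Perm (Fin n)) :
    lead d (oneLine π) = lead d ((List.range' 1 n).map (word π)) := by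
  rw [← map_oneLine, lead_map (strictMono_succ_val n)]

theorem word_ne_word {n : ℕ} (π : Equiv.Perm (Fin n)) {i j : ℕ} (hi : i ∈ Finset.Icc 1 n)
    (hij : i ≠ j) : word π i ≠ word π j := by
  rw [Finset.mem_Icc] at hi
  unfold word
  rw [dif_pos hi]
  split_ifs with h
  · intro e
    have e' := π.injective (Fin.ext (Nat.add_right_cancel e))
    simp only [Fin.mk.injEq] at e'
    omega
  · omega

theorem peakAt_iff {n : ℕ} (π : Equiv.Perm (Fin n)) {i : ℕ} (hi : i ∈ Finset.Icc 1 n) :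
    PeakAt π i ↔ isPeak (decide (word π (i - 1) < word π i))
      (decide (word π i < word π (i + 1))) = true := by
  have := word_ne_word π hi (Nat.succ_ne_self i).symm
  simp only [PeakAt, isPeak, Bool.and_eq_true, decide_eq_true_eq, Bool.not_eq_true',
    decide_eq_false_iff_not, Nat.succ_eq_add_one] at *
  omega

theorem changeAt_iff {n : ℕ} (π : Equiv.Perm (Fin n)) {i : ℕ} (hi : i ∈ Finset.Icc 1 n) :
    PeakAt π i ∨ ValleyAt π i ↔ xor (decide (word π (i - 1) < word π i))
      (decide (word π i < word π (i + 1))) = true := by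
  have h₁ := word_ne_word π hi (Nat.succ_ne_self i).symm
  have h₂ := word_ne_word π hi (show i ≠ i - 1 by rw [Finset.mem_Icc] at hi; omega)
  by_cases h : word π (i - 1) < word π i <;> by_cases h' : word π i < word π (i + 1) <;>
    simp [PeakAt, ValleyAt, h, h'] <;> simp only [Nat.succ_eq_add_one] at h₁ <;> omega

theorem numRuns_eq {n : ℕ} (π : Equiv.Perm (Fin n)) : numRuns π = blocks (dirs (oneLine π)) := by
  rw [dirs_oneLine]
  match n, π with
  | 0, π => simp [numRuns, dirs, blocks]
  | 1, π => simp [numRuns, dirs, dirsFrom, blocks]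
  | n + 2, π =>
    have := adj_dirsFrom_eq_card xor (word π) 1 n
    simp only [numRuns, numChanges, List.range'_succ, List.map_cons, dirs, dirsFrom, blocks] at this ⊢
    rw [this, if_neg (by omega), add_comm, show n + 2 - 1 = 1 + n by omega]
    congr 2
    refine Finset.filter_congr fun i hi => changeAt_iff π ?_
    simp only [Finset.mem_Icc] at hi ⊢
    omega

theorem numInteriorPeaks_eq {n : ℕ} (π : Equiv.Perm (Fin n)) :
    numInteriorPeaks π = pairs isPeak (dirs (oneLine π)) := by
  rw [dirs_oneLine]
  match n, π with
  | 0, π => simp [numInteriorPeaks, dirs, pairs]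
  | 1, π => simp [numInteriorPeaks, dirs, dirsFrom, pairs]
  | n + 2, π =>
    have := adj_dirsFrom_eq_card isPeak (word π) 1 n
    simp only [numInteriorPeaks, List.range'_succ, List.map_cons, dirs, dirsFrom, pairs] at this ⊢
    rw [this, show n + 2 - 1 = 1 + n by omega]
    congr 1
    refine Finset.filter_congr fun i hi => peakAt_iff π ?_
    simp only [Finset.mem_Icc] at hi ⊢
    omega

theorem numLeftPeaks_eq {n : ℕ} (π : Equiv.Perm (Fin n)) :
    numLeftPeaks π = pairs isPeak (lead true (oneLine π)) := by
  rw [lead_oneLine]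
  match n, π with
  | 0, π => simp [numLeftPeaks, lead, pairs]
  | n + 1, π =>
    have := adj_dirsFrom_eq_card isPeak (word π) 0 n
    -- The convention `π(0) = 0` makes the step into position `1` an ascent.
    have h0 : word π 0 < word π (0 + 1) := by simp [word]
    simp only [numLeftPeaks, List.range'_succ, List.map_cons, lead, pairs, h0, decide_true] at this ⊢
    simp only [zero_add, Nat.add_sub_cancel] at this ⊢
    rw [this]
    congr 1
    refine Finset.filter_congr fun i hi => peakAt_iff π ?_
    simp only [Finset.mem_Icc] at hi ⊢
    omega

/-! ### The longest alternating subsequence -/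

/-- `a :: l` is alternating, beginning with a descent if `d` and with an ascent otherwise. -/
def AltFrom : Bool → α → List α → Prop
  | _, _, [] => True
  | d, a, b :: l => (if d then b < a else a < b) ∧ AltFrom (!d) b l

theorem adj_xor_le_cons (d e : Bool) (D : List Bool) :
    adj xor d D ≤ adj xor d (e :: D) := by
  cases D with
  | nil => simp [adj]
  | cons f D => cases d <;> cases e <;> cases f <;> simp [adj] <;> omega

/-- Exchange argument. If the first step `a → b` goes the way `d` asks for, it pays for one letter
and the rest lies in `b :: l`. If not, `b` is at least as extreme as `a` and can replace it as the
starting letter. -/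
theorem length_le_of_altFrom (l : List α) : ∀ (a c : α) (s : List α) (d : Bool),
    (a :: l).Nodup → (c :: s).Sublist (a :: l) → AltFrom d c s →
      s.length ≤ adj xor d (dirsFrom a l) := by
  induction l with
  | nil =>
    intro a c s d _ hs _
    have := hs.length_le
    simp at this
    simp [this]
  | cons b l ih =>
    intro a c s d hnd hs halt
    have hnd' : (b :: l).Nodup := (List.nodup_cons.1 hnd).2
    have hab : a ≠ b := fun h => (List.nodup_cons.1 hnd).1 (by simp [h])
    rw [dirsFrom]
    rcases List.sublist_cons_iff.1 hs with hs' | ⟨r, hr, hs'⟩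
    · exact (ih b c s d hnd' hs' halt).trans (adj_xor_le_cons _ _ _)
    · obtain ⟨rfl, rfl⟩ := List.cons_eq_cons.1 hr
      cases s with
      | nil => simp
      | cons e s =>
        obtain ⟨h1, h2⟩ := halt
        by_cases hd : xor d (decide (c < b)) = true
        · have he : decide (c < b) = !d := by
            revert hd; cases d <;> cases decide (c < b) <;> simp
          have := ih b e s (!d) hnd' hs' h2
          have hx : xor d (!d) = true := by cases d <;> rfl
          simp only [List.length_cons, adj, he, hx, if_true] at this ⊢
          omega
        · have he : decide (c < b) = d := by
            revert hd; cases d <;> cases decide (c < b) <;> simp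
          have hbe : if d then e < b else b < e := by
            cases d
            · simp only [decide_eq_false_iff_not, not_lt, Bool.false_eq_true, if_false] at he h1 ⊢
              exact he.trans_lt h1
            · simp only [decide_eq_true_eq, if_true] at he h1 ⊢
              exact h1.trans he
          have hne : e ≠ b := by
            rintro rfl
            cases d <;> simp at hbe
          have hsl : (e :: s).Sublist l := by
            rcases List.sublist_cons_iff.1 hs' with h | ⟨r, hr, _⟩
            · exact h
            · exact absurd (List.cons_eq_cons.1 hr).1 hne
          have := ih b b (e :: s) d hnd' (hsl.cons_cons b) ⟨hbe, h2⟩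
          rw [he]
          simpa [adj] using this

/-- The greedy choice of one letter per block attains the bound. That `c` is at least as extreme as
`a` is what lets the induction prepend a letter when the direction changes. -/
theorem exists_altFrom (l : List α) : ∀ (a : α) (d : Bool), (a :: l).Nodup →
    ∃ c s, (c :: s).Sublist (a :: l) ∧ AltFrom d c s ∧ (if d then a ≤ c else c ≤ a) ∧
      s.length = adj xor d (dirsFrom a l) := by
  induction l with
  | nil => exact fun a d _ => ⟨a, [], List.Sublist.refl _, trivial, by simp, rfl⟩
  | cons b l ih =>
    intro a d hnd
    have hnd' : (b :: l).Nodup := (List.nodup_cons.1 hnd).2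
    have hab : a ≠ b := fun h => (List.nodup_cons.1 hnd).1 (by simp [h])
    rw [dirsFrom]
    by_cases hd : xor d (decide (a < b)) = true
    · have he : decide (a < b) = !d := by
        revert hd; cases d <;> cases decide (a < b) <;> simp
      obtain ⟨c, s, h1, h2, h3, h4⟩ := ih b (!d) hnd'
      refine ⟨a, c :: s, h1.cons_cons a, ⟨?_, h2⟩, by simp, ?_⟩
      · cases d
        · simp only [Bool.not_false, decide_eq_true_eq, if_true, Bool.false_eq_true, if_false] at *
          exact he.trans_le h3
        · simp only [Bool.not_true, decide_eq_false_iff_not, not_lt, if_true, Bool.false_eq_true,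
            if_false] at *
          exact h3.trans_lt (lt_of_le_of_ne he hab.symm)
      · have hx : xor d (!d) = true := by cases d <;> rfl
        simp only [List.length_cons, adj, he, hx, if_true, h4]
        omega
    · have he : decide (a < b) = d := by
        revert hd; cases d <;> cases decide (a < b) <;> simp
      obtain ⟨c, s, h1, h2, h3, h4⟩ := ih b d hnd'
      refine ⟨c, s, h1.cons a, h2, ?_, by simp [adj, he, h4]⟩
      cases d
      · simp only [decide_eq_false_iff_not, not_lt, Bool.false_eq_true, if_false] at *
        exact h3.trans he
      · simp only [decide_eq_true_eq, if_true] at *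
        exact he.le.trans h3

theorem altFrom_iff (s : List α) : ∀ (d : Bool) (c : α), AltFrom d c s ↔
    ∀ (j : ℕ) (hj : j + 1 < (c :: s).length),
      if xor (decide (Even j)) (!d) then (c :: s)[j] > (c :: s)[j + 1]
      else (c :: s)[j] < (c :: s)[j + 1] := by
  induction s with
  | nil => simp [AltFrom]
  | cons e s ih =>
    intro d c
    rw [AltFrom, ih]
    constructor
    · rintro ⟨h1, h2⟩ (_ | j) hj
      · cases d <;> simpa using h1
      · have := h2 j (by simpa using hj)
        simp only [Nat.even_add_one]
        by_cases hp : Even j <;> cases d <;> simpa [hp] using this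
    · intro h
      refine ⟨?_, fun j hj => ?_⟩
      · have := h 0 (by simp)
        cases d <;> simpa using this
      · have := h (j + 1) (by simpa using hj)
        simp only [Nat.even_add_one] at this
        by_cases hp : Even j <;> cases d <;> simpa [hp] using this

theorem isAlternatingSubsequence_iff {n : ℕ} (π : Equiv.Perm (Fin n)) (k : ℕ) :
    (∃ i : Fin (k + 1) → Fin n, IsAlternatingSubsequence π i) ↔
      ∃ c s, (c :: s).Sublist (oneLine π) ∧ AltFrom true c s ∧ s.length = k := by
  constructor
  · rintro ⟨i, hi, h⟩
    refine ⟨π (i 0), List.ofFn (fun j : Fin k => π (i j.succ)), ?_, ?_, by simp⟩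
    · have e : π (i 0) :: List.ofFn (fun j : Fin k => π (i j.succ)) = List.ofFn (π ∘ i) := by
        rw [List.ofFn_succ]; rfl
      rw [e, List.sublist_iff_exists_fin_orderEmbedding_get_eq]
      refine ⟨OrderEmbedding.ofStrictMono
        (fun j => Fin.cast (by simp [oneLine]) (i (Fin.cast (by simp) j))) ?_, ?_⟩
      · intro a b hab
        have := @hi (Fin.cast (by simp) a) (Fin.cast (by simp) b) hab
        simpa using this
      · intro ix
        simp only [oneLine, List.get_eq_getElem, List.getElem_ofFn]
        rfl
    · rw [altFrom_iff]
      intro j hj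
      have hj' : j + 1 < k + 1 := by simpa using hj
      have e : π (i 0) :: List.ofFn (fun j : Fin k => π (i j.succ)) = List.ofFn (π ∘ i) := by
        rw [List.ofFn_succ]; rfl
      have := h j hj'
      simp only [e, List.getElem_ofFn, Function.comp]
      simpa using this
  · rintro ⟨c, s, hs, halt, rfl⟩
    rw [List.sublist_iff_exists_fin_orderEmbedding_get_eq] at hs
    obtain ⟨f, hf⟩ := hs
    refine ⟨fun j => Fin.cast (by simp [oneLine]) (f j), ?_, ?_⟩
    · intro a b hab
      have := f.strictMono hab
      simpa using this
    · intro j hj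
      have := (altFrom_iff _ _ _).1 halt j hj
      have h1 := hf ⟨j, by simp; omega⟩
      have h2 := hf ⟨j + 1, hj⟩
      simp only [List.get_eq_getElem] at h1 h2
      rw [h1, h2] at this
      simp only [oneLine, List.getElem_ofFn, decide_eq_true_eq, Bool.not_true, Bool.xor_false] at this
      exact this

theorem nodup_oneLine {n : ℕ} (π : Equiv.Perm (Fin n)) : (oneLine π).Nodup :=
  List.nodup_ofFn.2 π.injective

theorem longestAlternating_eq {n : ℕ} (π : Equiv.Perm (Fin n)) :
    longestAlternating π = blocks (lead true (oneLine π)) := by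
  have hnd := nodup_oneLine π
  have hiff := isAlternatingSubsequence_iff π
  unfold longestAlternating
  apply le_antisymm
  · refine csSup_le' ?_
    rintro (_ | k) hk
    · exact Nat.zero_le _
    · obtain ⟨c, s, h1, h2, rfl⟩ := (hiff k).1 hk
      cases hl : oneLine π with
      | nil => simp [hl] at h1
      | cons a l =>
        rw [hl] at h1 hnd
        have := length_le_of_altFrom l a c s true hnd h1 h2
        simp only [lead, blocks]
        omega
  · cases hl : oneLine π with
    | nil => exact Nat.zero_le _
    | cons a l =>
      rw [hl] at hnd hiff
      obtain ⟨c, s, h1, h2, -, h4⟩ := exists_altFrom l a true hnd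
      refine le_csSup (bddAbove_alternating π) ?_
      rw [lead, blocks, add_comm]
      exact (hiff _).2 ⟨c, s, h1, h2, h4⟩

/-! ### Words on a set of letters, cut at a letter -/

/-- The words that contain every letter of `A` exactly once. -/
def words (A : Finset α) : Finset (List α) := A.val.lists.toFinset

theorem mem_words_iff (A : Finset α) (l : List α) :
    l ∈ words A ↔ l.Nodup ∧ l.toFinset = A := by
  rw [words, Multiset.mem_toFinset, Multiset.mem_lists_iff]
  constructor
  · intro h
    have hnd : l.Nodup := by
      have := A.nodup
      rw [h] at this
      exact this
    refine ⟨hnd, Finset.val_injective ?_⟩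
    rw [h, List.toFinset_val, hnd.dedup]
    rfl
  · rintro ⟨h, rfl⟩
    rw [List.toFinset_val, h.dedup]
    rfl

/-- Standardization: the increasing enumeration of `A` turns permutations of `Fin k` into words on
`A`. Direction words are unchanged by it, so sums over the letters on one side of a cut depend only
on their number. -/
theorem sum_words_eq_sum_perm {M : Type*} [AddCommMonoid M] (A : Finset α) {k : ℕ}
    (hk : A.card = k) (f : List α → M) :
    ∑ l ∈ words A, f l =
      ∑ π : Equiv.Perm (Fin k), f ((oneLine π).map (A.orderEmbOfFin hk)) := by
  symm
  refine Finset.sum_bij (fun π _ => (oneLine π).map (A.orderEmbOfFin hk)) ?_ ?_ ?_ (fun _ _ => rfl)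
  · intro π _
    rw [mem_words_iff]
    refine ⟨(nodup_oneLine π).map (A.orderEmbOfFin hk).injective, ?_⟩
    ext x
    simp only [List.mem_toFinset, List.mem_map, oneLine, List.mem_ofFn]
    rw [← Finset.mem_coe, ← Finset.range_orderEmbOfFin A hk]
    constructor
    · rintro ⟨_, -, rfl⟩
      exact ⟨_, rfl⟩
    · rintro ⟨y, rfl⟩
      exact ⟨y, ⟨π.symm y, by simp⟩, rfl⟩
  · intro π _ ρ _ h
    have h' := List.map_injective_iff.2 (A.orderEmbOfFin hk).injective h
    exact Equiv.coe_fn_injective (List.ofFn_injective h')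
  · intro l hl
    obtain ⟨hnd, rfl⟩ := (mem_words_iff _ _).1 hl
    have hlen : l.length = k := by rw [← hk, List.toFinset_card_of_nodup hnd]
    subst hlen
    let p : Fin l.length → Fin l.length := fun i =>
      (l.toFinset.orderIsoOfFin hk).symm ⟨l[i], by simp⟩
    have hp : Function.Injective p := by
      intro i j hij
      have := Subtype.ext_iff.1 ((OrderIso.injective _) hij)
      exact Fin.ext ((hnd.getElem_inj_iff).1 this)
    refine ⟨Equiv.ofBijective p (Finite.injective_iff_bijective.1 hp), Finset.mem_univ _, ?_⟩
    apply List.ext_getElem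
    · simp [oneLine]
    · intro i h₁ h₂
      simp only [oneLine, List.getElem_map, List.getElem_ofFn, Equiv.ofBijective_apply, p]
      rw [← Finset.coe_orderIsoOfFin_apply]
      simp

theorem sum_words_split {M : Type*} [AddCommMonoid M] (S : Finset α) {m : α} (hm : m ∈ S)
    (f : List α → M) :
    ∑ l ∈ words S, f l = ∑ A ∈ (S.erase m).powerset, ∑ σ ∈ words A,
      ∑ τ ∈ words (S.erase m \ A), f (σ ++ m :: τ) := by
  symm
  simp_rw [← Finset.sum_product', Finset.sum_sigma']
  refine Finset.sum_bij (fun x _ => x.2.1 ++ m :: x.2.2) ?_ ?_ ?_ (fun _ _ => rfl)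
  · rintro ⟨A, σ, τ⟩ h
    simp only [Finset.mem_sigma, Finset.mem_powerset, Finset.mem_product, mem_words_iff] at h ⊢
    obtain ⟨hA, ⟨hσ, rfl⟩, hτ, hτ'⟩ := h
    have hmem : ∀ x, x ∈ τ ↔ (x ≠ m ∧ x ∈ S) ∧ x ∉ σ := by
      intro x
      rw [← List.mem_toFinset, hτ']
      simp
    have hσm : m ∉ σ := fun h => by simpa using hA (List.mem_toFinset.2 h)
    refine ⟨?_, ?_⟩
    · rw [List.nodup_append]
      refine ⟨hσ, List.nodup_cons.2 ⟨fun h => ((hmem m).1 h).1.1 rfl, hτ⟩, ?_⟩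
      rintro a ha b hb rfl
      rcases List.mem_cons.1 hb with rfl | hb
      · exact hσm ha
      · exact ((hmem a).1 hb).2 ha
    · ext x
      have hx : x ∈ σ → x ∈ S := fun h => (Finset.mem_erase.1 (hA (List.mem_toFinset.2 h))).2
      simp only [List.mem_toFinset, List.mem_append, List.mem_cons, hmem]
      by_cases hxm : x = m
      · simp [hxm, hm]
      · tauto
  · rintro ⟨A, σ, τ⟩ h ⟨A', σ', τ'⟩ h' he
    simp only [Finset.mem_sigma, Finset.mem_powerset, Finset.mem_product, mem_words_iff] at h h'
    obtain ⟨hA, ⟨hσ, rfl⟩, hτ, hτ'⟩ := h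
    obtain ⟨hA', ⟨hσ', rfl⟩, hτ₂, hτ₂'⟩ := h'
    have hσm : m ∉ σ := fun h => by simpa using hA (List.mem_toFinset.2 h)
    have hσm' : m ∉ σ' := fun h => by simpa using hA' (List.mem_toFinset.2 h)
    have hτm : m ∉ τ := fun h => by simpa [hτ'] using List.mem_toFinset.2 h
    have hτm' : m ∉ τ' := fun h => by simpa [hτ₂'] using List.mem_toFinset.2 h
    obtain ⟨rfl, -, rfl⟩ := (List.append_cons_inj_of_notMem hσm hτm).1 he
    rfl
  · intro l hl
    obtain ⟨hnd, rfl⟩ := (mem_words_iff _ _).1 hl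
    obtain ⟨σ, τ, rfl⟩ := List.append_of_mem (List.mem_toFinset.1 hm)
    obtain ⟨h1, h2, h3⟩ := List.nodup_append.1 hnd
    have h4 := List.nodup_cons.1 h2
    refine ⟨⟨σ.toFinset, σ, τ⟩, ?_, rfl⟩
    simp only [Finset.mem_sigma, Finset.mem_powerset, Finset.mem_product, mem_words_iff]
    refine ⟨?_, ⟨h1, trivial⟩, h4.2, ?_⟩
    · intro x hx
      rw [List.mem_toFinset] at hx
      exact Finset.mem_erase.2 ⟨h3 x hx m (by simp), by simp [hx]⟩
    · ext x
      simp only [List.mem_toFinset, Finset.mem_sdiff, Finset.mem_erase, List.mem_append,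
        List.mem_cons]
      constructor
      · intro hx
        exact ⟨⟨fun h => h4.1 (h ▸ hx), by simp [hx]⟩, fun h => h3 x h x (by simp [hx]) rfl⟩
      · tauto

/-! ### Binomial convolution -/

/-- The binomial convolution of two sequences. -/
noncomputable def conv (a b : ℕ → ℤ[X]) (n : ℕ) : ℤ[X] :=
  ∑ k ∈ Finset.range (n + 1), (n.choose k : ℤ[X]) * a k * b (n - k)

theorem sum_perm_split {n : ℕ} (m : Fin (n + 1)) (f g h : List (Fin (n + 1)) → ℤ[X])
    (G H : ℕ → ℤ[X]) (hG : ∀ A : Finset (Fin (n + 1)), ∑ l ∈ words A, g l = G A.card)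
    (hH : ∀ A : Finset (Fin (n + 1)), ∑ l ∈ words A, h l = H A.card)
    (hf : ∀ σ τ, (∀ x ∈ σ, x ≠ m) → (∀ x ∈ τ, x ≠ m) → σ.length + τ.length = n →
      f (σ ++ m :: τ) = g σ * h τ) :
    ∑ π : Equiv.Perm (Fin (n + 1)), f (oneLine π) = conv G H n := by
  have h1 := sum_words_eq_sum_perm (Finset.univ : Finset (Fin (n + 1))) (Finset.card_fin _) f
  have hid : ⇑(Finset.univ.orderEmbOfFin (Finset.card_fin (n + 1))) = id :=
    (Finset.orderEmbOfFin_unique _ (fun _ => Finset.mem_univ _) strictMono_id).symm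
  simp only [hid, List.map_id] at h1
  rw [← h1, sum_words_split _ (Finset.mem_univ m)]
  have hc : (Finset.univ.erase m).card = n := by simp
  have h2 : ∀ A ∈ (Finset.univ.erase m).powerset, (∑ σ ∈ words A,
      ∑ τ ∈ words (Finset.univ.erase m \ A), f (σ ++ m :: τ)) =
      G A.card * H (n - A.card) := by
    intro A hA
    rw [Finset.mem_powerset] at hA
    have hcard : (Finset.univ.erase m \ A).card = n - A.card := by
      rw [Finset.card_sdiff_of_subset hA, hc]
    rw [← hG, ← hcard, ← hH, Finset.sum_mul_sum]
    refine Finset.sum_congr rfl fun σ hσ => Finset.sum_congr rfl fun τ hτ => ?_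
    obtain ⟨hσn, rfl⟩ := (mem_words_iff _ _).1 hσ
    obtain ⟨hτn, hτ'⟩ := (mem_words_iff _ _).1 hτ
    refine hf σ τ ?_ ?_ ?_
    · rintro x hx rfl
      simpa using hA (List.mem_toFinset.2 hx)
    · rintro x hx rfl
      simpa [hτ'] using List.mem_toFinset.2 hx
    · rw [← hτ', List.toFinset_card_of_nodup hσn, List.toFinset_card_of_nodup hτn] at hcard
      have := Finset.card_le_card hA
      rw [hc, List.toFinset_card_of_nodup hσn] at this
      omega
  rw [Finset.sum_congr rfl h2,
    Finset.sum_powerset_apply_card (fun k => G k * H (n - k)), hc, conv]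
  refine Finset.sum_congr rfl fun k _ => ?_
  rw [nsmul_eq_mul, mul_assoc]

theorem conv_comm (a b : ℕ → ℤ[X]) (n : ℕ) : conv a b n = conv b a n := by
  unfold conv
  rw [← Finset.sum_flip]
  refine Finset.sum_congr rfl fun k hk => ?_
  have hk : k ≤ n := Nat.lt_succ_iff.1 (Finset.mem_range.1 hk)
  rw [Nat.choose_symm hk, Nat.sub_sub_self hk]
  ring

/-- Pascal's rule, in the form of the Leibniz rule for the index shift. -/
theorem conv_succ (a b : ℕ → ℤ[X]) (n : ℕ) :
    conv a b (n + 1) = conv (fun k => a (k + 1)) b n + conv a (fun k => b (k + 1)) n := by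
  have := Finset.sum_choose_succ_mul (fun i j => a i * b j) n
  unfold conv
  simp only [mul_assoc]
  rw [this, add_comm]
  refine congrArg₂ (· + ·) rfl (Finset.sum_congr rfl fun k hk => ?_)
  rw [Nat.succ_sub (Nat.lt_succ_iff.1 (Finset.mem_range.1 hk))]

theorem conv_add_left (a b c : ℕ → ℤ[X]) (n : ℕ) :
    conv (fun k => a k + b k) c n = conv a c n + conv b c n := by
  simp [conv, mul_add, add_mul, Finset.sum_add_distrib]

theorem conv_add_right (a b c : ℕ → ℤ[X]) (n : ℕ) :
    conv a (fun k => b k + c k) n = conv a b n + conv a c n := by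
  simp [conv, mul_add, Finset.sum_add_distrib]

theorem conv_mul_right (p : ℤ[X]) (a b : ℕ → ℤ[X]) (n : ℕ) :
    conv a (fun k => p * b k) n = p * conv a b n := by
  rw [conv, conv, Finset.mul_sum]
  exact Finset.sum_congr rfl fun k _ => by ring

/-- Both sides agree at `0` and obey the same Leibniz rule, so induction over all triples of
sequences suffices. -/
theorem conv_assoc (a b c : ℕ → ℤ[X]) (n : ℕ) :
    conv (fun k => conv a b k) c n = conv a (fun k => conv b c k) n := by
  induction n generalizing a b c with
  | zero => simp [conv, mul_assoc]
  | succ n ih =>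
    have hs (a b : ℕ → ℤ[X]) : (fun k => conv a b (k + 1)) =
        fun k => conv (fun j => a (j + 1)) b k + conv a (fun j => b (j + 1)) k :=
      funext (conv_succ a b)
    rw [conv_succ, conv_succ, hs a b, hs b c, conv_add_left, conv_add_right, ih, ih, ih]
    ring

/-! ### Direction words and blocks under cutting, complement and reversal -/

theorem dirs_split (m : α) {u v : Bool} (σ τ : List α) (hσ : ∀ x ∈ σ, decide (x < m) = u)
    (hτ : ∀ x ∈ τ, decide (m < x) = v) :
    dirs (σ ++ m :: τ) = trail u σ ++ lead v τ := by
  have h0 : dirsFrom m τ = lead v τ := by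
    cases τ with
    | nil => rfl
    | cons b τ => rw [dirsFrom, lead, hτ b (by simp)]
  cases σ with
  | nil => exact h0
  | cons a σ =>
    simp only [List.cons_append, dirs, trail]
    induction σ generalizing a with
    | nil => simp [dirsFrom, h0, hσ a (by simp)]
    | cons b σ ih =>
      simp only [List.cons_append, dirsFrom, ih b (fun x hx => hσ x (by simp_all))]

theorem lead_split (d : Bool) (m : α) {u v : Bool} (σ τ : List α)
    (hσ : ∀ x ∈ σ, decide (x < m) = u) (hτ : ∀ x ∈ τ, decide (m < x) = v) :
    lead d (σ ++ m :: τ) = d :: (trail u σ ++ lead v τ) := by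
  rw [← dirs_split m σ τ hσ hτ]
  cases σ <;> rfl

theorem dirsFrom_map_anti {f : α → β} (hf : StrictAnti f) (a : α) (l : List α)
    (h : (a :: l).Nodup) : dirsFrom (f a) (l.map f) = (dirsFrom a l).map not := by
  induction l generalizing a with
  | nil => rfl
  | cons b l ih =>
    have hab : a ≠ b := fun e => (List.nodup_cons.1 h).1 (by simp [e])
    simp only [List.map_cons, dirsFrom, ih b (List.nodup_cons.1 h).2, hf.lt_iff_gt,
      List.cons.injEq, and_true]
    rcases hab.lt_or_gt with h | h <;> simp [h, h.not_gt]

theorem dirs_map_anti {f : α → β} (hf : StrictAnti f) {l : List α} (h : l.Nodup) :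
    dirs (l.map f) = (dirs l).map not := by
  cases l with
  | nil => rfl
  | cons a l => exact dirsFrom_map_anti hf a l h

theorem lead_map_anti {f : α → β} (hf : StrictAnti f) (d : Bool) {l : List α} (h : l.Nodup) :
    lead (!d) (l.map f) = (lead d l).map not := by
  cases l with
  | nil => rfl
  | cons a l => simp [lead, dirsFrom_map_anti hf a l h]

theorem dirs_append_pair (l : List α) (a b : α) :
    dirs (l ++ [a, b]) = dirs (l ++ [a]) ++ [decide (a < b)] := by
  cases l with
  | nil => rfl
  | cons c l =>
    simp only [List.cons_append, dirs]
    induction l generalizing c with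
    | nil => rfl
    | cons e l ih => simp [dirsFrom, ih]

theorem dirs_reverse_map_anti {f : α → β} (hf : StrictAnti f) (l : List α) :
    dirs (l.map f).reverse = (dirs l).reverse := by
  cases l with
  | nil => rfl
  | cons a l =>
    induction l generalizing a with
    | nil => rfl
    | cons b l ih =>
      have := ih b
      simp only [List.map_cons, List.reverse_cons, List.append_assoc, List.singleton_append,
        dirs_append_pair] at this ⊢
      rw [this]
      simp [hf.lt_iff_gt, dirs, dirsFrom]

theorem trail_eq_of_ne_nil (d : Bool) {l : List α} (h : l ≠ []) : trail d l = dirs l ++ [d] := by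
  cases l with
  | nil => exact absurd rfl h
  | cons a l => rfl

theorem lead_eq_of_ne_nil (d : Bool) {l : List α} (h : l ≠ []) : lead d l = d :: dirs l := by
  cases l with
  | nil => exact absurd rfl h
  | cons a l => rfl

theorem trail_reverse_map_anti {f : α → β} (hf : StrictAnti f) (d : Bool) (l : List α) :
    trail d (l.map f).reverse = (lead d l).reverse := by
  by_cases h : l = []
  · subst h; rfl
  · rw [trail_eq_of_ne_nil d (by simpa using h), lead_eq_of_ne_nil d h, dirs_reverse_map_anti hf,
      List.reverse_cons]

theorem adj_append (P : Bool → Bool → Bool) (B C : List Bool) (d e : Bool) :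
    adj P d (B ++ e :: C) = adj P d (B ++ [e]) + adj P e C := by
  induction B generalizing d with
  | nil => simp [adj]
  | cons b B ih => simp [adj, ih, add_assoc]

theorem pairs_append (P : Bool → Bool → Bool) (B C : List Bool) (e : Bool) :
    pairs P (B ++ e :: C) = pairs P (B ++ [e]) + adj P e C := by
  cases B with
  | nil => simp [pairs, adj]
  | cons b B => exact adj_append P B C b e

theorem blocks_eq_of_ne_nil {B : List Bool} (h : B ≠ []) : blocks B = 1 + pairs xor B := by
  cases B with
  | nil => exact absurd rfl h
  | cons b B => rfl

theorem pairs_xor_reverse (B : List Bool) : pairs xor B.reverse = pairs xor B := by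
  cases B with
  | nil => rfl
  | cons b B =>
    induction B generalizing b with
    | nil => rfl
    | cons c B ih =>
      rw [List.reverse_cons, List.reverse_cons, List.append_assoc, List.singleton_append,
        pairs_append, ← List.reverse_cons, ih c]
      simp [pairs, adj, Bool.xor_comm c b, add_comm]

theorem blocks_reverse (B : List Bool) : blocks B.reverse = blocks B := by
  by_cases h : B = []
  · subst h; rfl
  · rw [blocks_eq_of_ne_nil h, blocks_eq_of_ne_nil (by simpa using h), pairs_xor_reverse]

theorem adj_xor_map_not (d : Bool) (B : List Bool) :
    adj xor (!d) (B.map not) = adj xor d B := by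
  induction B generalizing d with
  | nil => rfl
  | cons b B ih => simp [adj, ih]

theorem blocks_map_not (B : List Bool) : blocks (B.map not) = blocks B := by
  cases B with
  | nil => rfl
  | cons b B => simp [blocks, adj_xor_map_not]

/-- No block crosses a junction where the direction switches. -/
theorem blocks_append (B : List Bool) (d : Bool) (C : List Bool) :
    blocks (B ++ d :: (!d) :: C) = blocks (B ++ [d]) + blocks ((!d) :: C) := by
  rw [blocks_eq_of_ne_nil (by simp), blocks_eq_of_ne_nil (by simp), pairs_append, blocks]
  cases d <;> simp [adj] <;> omega

theorem blocks_append_lead (B : List Bool) (d : Bool) (l : List α) :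
    blocks (B ++ d :: lead (!d) l) = blocks (B ++ [d]) + blocks (lead (!d) l) := by
  cases l with
  | nil => rfl
  | cons a l => exact blocks_append B d _

theorem blocks_trail_append_lead (d : Bool) (σ τ : List α) :
    blocks (trail d σ ++ lead (!d) τ) = blocks (trail d σ) + blocks (lead (!d) τ) := by
  by_cases h : σ = []
  · subst h; simp [trail, blocks]
  · rw [trail_eq_of_ne_nil d h, List.append_assoc, List.singleton_append, blocks_append_lead]

/-- Peaks and valleys alternate, and the final ascent makes a valley follow every peak. An initial
descent adds one valley with no peak before it. -/
theorem adj_xor_append_true (d : Bool) (B : List Bool) :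
    adj xor d (B ++ [true]) = (if d then 0 else 1) + 2 * adj isPeak d B := by
  induction B generalizing d with
  | nil => cases d <;> simp [adj]
  | cons b B ih => cases d <;> cases b <;> simp [adj, ih, isPeak] <;> omega

theorem blocks_lead_append_true (l : List α) :
    blocks (lead true l ++ [true]) = 1 + 2 * pairs isPeak (lead true l) := by
  cases l with
  | nil => rfl
  | cons a l => simp [lead, blocks, pairs, adj_xor_append_true]

/-- Negation reduces this to a word that starts with a descent and ends with an ascent; the peaks of
`B.map not` are the valleys of `B`. -/
theorem blocks_true_append_false (B : List Bool) :
    blocks (true :: B ++ [false]) = 2 + 2 * pairs isPeak (B.map not) := by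
  rw [← blocks_map_not]
  have h : adj isPeak false (B.map not) = pairs isPeak (B.map not) := by
    cases B with
    | nil => rfl
    | cons b B => simp [adj, pairs, isPeak]
  simp only [List.cons_append, List.map_cons, List.map_append, List.map_nil, Bool.not_true,
    Bool.not_false, blocks, adj_xor_append_true, h]
  simp
  omega

/-! ### The polynomials as sums over permutations and words -/

theorem sum_countStat {n N : ℕ} (stat : Equiv.Perm (Fin n) → ℕ) (h : ∀ π, stat π < N)
    (p : ℤ[X]) :
    ∑ k ∈ Finset.range N, (countStat stat k : ℤ[X]) * p ^ k = ∑ π, p ^ stat π := by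
  rw [← Finset.sum_fiberwise_of_maps_to (g := stat) (t := Finset.range N)
    (fun π _ => Finset.mem_range.2 (h π))]
  refine Finset.sum_congr rfl fun k _ => ?_
  rw [Finset.sum_congr rfl (g := fun _ => p ^ k)
    (fun π hπ => by rw [(Finset.mem_filter.1 hπ).2])]
  simp [countStat]

theorem R_eq (n : ℕ) :
    R (n + 1) = ∑ π : Equiv.Perm (Fin (n + 1)), X ^ blocks (dirs (oneLine π)) := by
  simp_rw [← numRuns_eq]
  refine sum_countStat numRuns (fun π => ?_) X
  unfold numRuns numChanges
  split_ifs
  · omega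
  · have := Finset.card_filter_le (Finset.Icc 2 (n + 1 - 1)) (fun i => PeakAt π i ∨ ValleyAt π i)
    rw [Nat.card_Icc] at this
    omega

theorem T_eq (n : ℕ) :
    T n = ∑ π : Equiv.Perm (Fin n), X ^ blocks (lead true (oneLine π)) := by
  simp_rw [← longestAlternating_eq]
  refine sum_countStat longestAlternating (fun π => Nat.lt_succ_iff.2 (csSup_le' ?_)) X
  rintro k ⟨i, hi, -⟩
  simpa using Fintype.card_le_of_injective i hi.injective

theorem W_comp_eq (n : ℕ) : (W n).comp (X ^ 2) =
    ∑ π : Equiv.Perm (Fin n), (X ^ 2) ^ pairs isPeak (dirs (oneLine π)) := by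
  simp_rw [← numInteriorPeaks_eq]
  rw [← sum_countStat numInteriorPeaks (N := n + 1) (fun π => ?_) (X ^ 2)]
  · simp [W, numW, Polynomial.sum_comp]
  · have := Finset.card_filter_le (Finset.Icc 2 (n - 1)) (fun i => PeakAt π i)
    rw [Nat.card_Icc] at this
    unfold numInteriorPeaks
    omega

theorem WTilde_comp_eq (n : ℕ) : (WTilde n).comp (X ^ 2) =
    ∑ π : Equiv.Perm (Fin n), (X ^ 2) ^ pairs isPeak (lead true (oneLine π)) := by
  simp_rw [← numLeftPeaks_eq]
  rw [← sum_countStat numLeftPeaks (N := n + 1) (fun π => ?_) (X ^ 2)]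
  · simp [WTilde, numWTilde, Polynomial.sum_comp]
  · have := Finset.card_filter_le (Finset.Icc 1 (n - 1)) (fun i => PeakAt π i)
    rw [Nat.card_Icc] at this
    unfold numLeftPeaks
    omega

theorem oneLine_revPerm_mul {n : ℕ} (π : Equiv.Perm (Fin n)) :
    oneLine (Fin.revPerm * π) = (oneLine π).map Fin.rev := by
  simp [oneLine, List.map_ofFn]
  rfl

theorem oneLine_mul_revPerm {n : ℕ} (π : Equiv.Perm (Fin n)) :
    oneLine (π * Fin.revPerm) = (oneLine π).reverse := by
  apply List.ext_getElem
  · simp [oneLine]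
  · intro i h₁ h₂
    simp only [oneLine, List.getElem_ofFn, List.getElem_reverse, List.length_ofFn,
      Equiv.Perm.mul_apply, Fin.revPerm_apply]
    congr 1
    ext
    simp [Fin.val_rev]
    omega

theorem sum_words_lead_true (A : Finset α) :
    ∑ l ∈ words A, (X : ℤ[X]) ^ blocks (lead true l) = T A.card := by
  rw [sum_words_eq_sum_perm A rfl, T_eq]
  simp_rw [lead_map (A.orderEmbOfFin rfl).strictMono]

/-- Complementing the letters flips all directions and keeps the number of blocks. -/
theorem sum_words_lead_false (A : Finset α) :
    ∑ l ∈ words A, (X : ℤ[X]) ^ blocks (lead false l) = T A.card := by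
  rw [sum_words_eq_sum_perm A rfl, T_eq]
  simp_rw [lead_map (A.orderEmbOfFin rfl).strictMono]
  rw [← Equiv.sum_comp (Equiv.mulLeft Fin.revPerm)]
  refine Finset.sum_congr rfl fun π _ => ?_
  have := lead_map_anti (Fin.rev_strictAnti (n := A.card)) true (nodup_oneLine π)
  rw [Bool.not_true] at this
  rw [Equiv.coe_mulLeft, oneLine_revPerm_mul, this, blocks_map_not]

/-- Reversing and complementing a word reverses its direction word, so the ascent at the end moves
to the front. -/
theorem sum_words_trail_true (A : Finset α) :
    ∑ l ∈ words A, (X : ℤ[X]) ^ blocks (trail true l) = T A.card := by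
  rw [sum_words_eq_sum_perm A rfl, T_eq]
  simp_rw [trail_map (A.orderEmbOfFin rfl).strictMono]
  rw [← Equiv.sum_comp ((Equiv.mulLeft Fin.revPerm).trans (Equiv.mulRight Fin.revPerm))]
  refine Finset.sum_congr rfl fun π _ => ?_
  rw [Equiv.trans_apply, Equiv.coe_mulLeft, Equiv.coe_mulRight, oneLine_mul_revPerm,
    oneLine_revPerm_mul, trail_reverse_map_anti Fin.rev_strictAnti, blocks_reverse]

/-- The factor `X` stands for the `1` in the block count `1 + 2 * peaks`. -/
theorem sum_words_left_peaks (A : Finset α) :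
    ∑ l ∈ words A, (X : ℤ[X]) * (X ^ 2) ^ pairs isPeak (lead true l) =
      X * (WTilde A.card).comp (X ^ 2) := by
  rw [← Finset.mul_sum, sum_words_eq_sum_perm A rfl, WTilde_comp_eq]
  simp_rw [lead_map (A.orderEmbOfFin rfl).strictMono]

theorem sum_words_valleys (A : Finset α) :
    ∑ l ∈ words A, ((X : ℤ[X]) ^ 2) ^ pairs isPeak ((dirs l).map not) =
      (W A.card).comp (X ^ 2) := by
  rw [sum_words_eq_sum_perm A rfl, W_comp_eq]
  simp_rw [dirs_map (A.orderEmbOfFin rfl).strictMono]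
  rw [← Equiv.sum_comp (Equiv.mulLeft Fin.revPerm)]
  refine Finset.sum_congr rfl fun π _ => ?_
  rw [Equiv.coe_mulLeft, oneLine_revPerm_mul, dirs_map_anti Fin.rev_strictAnti (nodup_oneLine π)]
  simp only [List.map_map, Bool.involutive_not.comp_self, List.map_id]

/-! ### The recurrences -/

theorem R_succ (n : ℕ) : R (n + 1) = conv T T n := by
  rw [R_eq]
  refine sum_perm_split (Fin.last n) (fun l => X ^ blocks (dirs l)) _ _ T T sum_words_trail_true
    sum_words_lead_false fun σ τ hσ hτ _ => ?_
  rw [dirs_split (Fin.last n) σ τ (u := true) (v := false)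
    (fun x hx => by simpa using Fin.lt_last_iff_ne_last.2 (hσ x hx))
    (fun x _ => by simpa using Fin.le_last x), ← pow_add]
  congr 1
  exact blocks_trail_append_lead true σ τ

theorem true_cons_trail_true (l : List α) : true :: trail true l = lead true l ++ [true] := by
  cases l <;> rfl

theorem T_succ (n : ℕ) : T (n + 1) = X * conv T (fun k => (WTilde k).comp (X ^ 2)) n := by
  rw [T_eq, ← conv_mul_right, conv_comm]
  refine sum_perm_split (Fin.last n) (fun l => X ^ blocks (lead true l)) _ _
    (fun k => X * (WTilde k).comp (X ^ 2)) T sum_words_left_peaks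
    sum_words_lead_false fun σ τ hσ hτ _ => ?_
  rw [lead_split true (Fin.last n) σ τ (u := true) (v := false)
    (fun x hx => by simpa using Fin.lt_last_iff_ne_last.2 (hσ x hx))
    (fun x _ => by simpa using Fin.le_last x), ← List.cons_append, true_cons_trail_true,
    List.append_assoc, List.singleton_append]
  have h := blocks_append_lead (lead true σ) true τ
  rw [Bool.not_true] at h
  rw [h, blocks_lead_append_true, pow_add, pow_add, pow_mul, pow_one]

/-- The distribution of the blocks to the left of the least letter, for `0` prepended. -/
noncomputable def leftOfMin (k : ℕ) : ℤ[X] :=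
  if k = 0 then 1 else X ^ 2 * (W k).comp (X ^ 2)

theorem sum_words_leftOfMin (A : Finset α) :
    ∑ l ∈ words A, (if l = [] then (1 : ℤ[X])
      else X ^ 2 * (X ^ 2) ^ pairs isPeak ((dirs l).map not)) = leftOfMin A.card := by
  by_cases hA : A = ∅
  · have : words A = {[]} := by
      ext l
      rw [mem_words_iff, hA, List.toFinset_eq_empty_iff, Finset.mem_singleton]
      exact ⟨fun h => h.2, by rintro rfl; simp⟩
    rw [this]
    simp [leftOfMin, hA]
  · rw [leftOfMin, if_neg (by simpa using hA), ← sum_words_valleys, Finset.mul_sum]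
    refine Finset.sum_congr rfl fun l hl => if_neg ?_
    rintro rfl
    exact hA ((mem_words_iff _ _).1 hl).2.symm

/-- The case `n = 0` fails, since `T 1 = X` while the convolution is `1`: with `σ` empty, the ascent
into the minimum merges into the first block of `τ` only if `τ` is nonempty. -/
theorem T_succ_eq_conv_leftOfMin {n : ℕ} (hn : 1 ≤ n) : T (n + 1) = conv T leftOfMin n := by
  rw [T_eq, conv_comm]
  refine sum_perm_split 0 (fun l => X ^ blocks (lead true l)) _ _ leftOfMin T sum_words_leftOfMin
    sum_words_lead_true fun σ τ hσ hτ hlen => ?_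
  rw [lead_split true 0 σ τ (u := false) (v := true) (fun x _ => by simp)
    (fun x hx => by simpa using Fin.pos_iff_ne_zero.2 (hτ x hx))]
  by_cases h : σ = []
  · subst h
    cases τ with
    | nil => simp at hlen; omega
    | cons b τ => simp [trail, lead, blocks, adj]
  · rw [if_neg h, trail_eq_of_ne_nil _ h, List.append_assoc, List.singleton_append,
      ← List.cons_append]
    have h' := blocks_append_lead (true :: dirs σ) false τ
    rw [Bool.not_false] at h'
    rw [h', blocks_true_append_false, pow_add, pow_add, pow_mul]

theorem R_one : R 1 = 1 := by
  rw [R_eq]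
  simp [oneLine, dirs, dirsFrom, blocks]

theorem R_add_two (n : ℕ) : R (n + 2) = 2 * conv T (fun k => T (k + 1)) n := by
  rw [R_succ (n + 1), conv_succ, conv_comm, two_mul]

theorem R_add_two_eq_conv_R (n : ℕ) : R (n + 2) =
    2 * X * conv (fun k => R (k + 1)) (fun k => (WTilde k).comp (X ^ 2)) n := by
  have h1 : (fun k => R (k + 1)) = fun k => conv T T k := funext R_succ
  have h2 : (fun k => T (k + 1)) = fun k => X * conv T (fun k => (WTilde k).comp (X ^ 2)) k :=
    funext T_succ
  -- Regrouping `(T * T) * W̃` as `T * (T * W̃)` makes the inner factor, times `X`, the shifted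
  -- sequence `T (k + 1)`.
  rw [R_add_two, h1, conv_assoc, h2, conv_mul_right, mul_assoc]

end PermPoly

theorem mainTheorem2 (n : ℕ) (hn : 1 ≤ n) :
    PermPoly.R (n + 1) =
        ∑ k ∈ Finset.range (n + 1),
          (n.choose k : ℤ[X]) * PermPoly.T k * PermPoly.T (n - k) ∧
    PermPoly.R (n + 2) =
        2 * ∑ k ∈ Finset.range (n + 1),
          (n.choose k : ℤ[X]) * PermPoly.T k * PermPoly.T (n - k + 1) ∧
    PermPoly.R (n + 2) =
        2 * X * (PermPoly.WTilde n).comp (X ^ 2) +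
          2 * X * ∑ k ∈ Finset.Icc 1 n,
            (n.choose k : ℤ[X]) * PermPoly.R (k + 1) * (PermPoly.WTilde (n - k)).comp (X ^ 2) ∧
    PermPoly.T (n + 1) =
        X * ∑ k ∈ Finset.range (n + 1),
          (n.choose k : ℤ[X]) * PermPoly.T k * (PermPoly.WTilde (n - k)).comp (X ^ 2) ∧
    PermPoly.T (n + 1) =
        PermPoly.T n +
          X ^ 2 * ∑ k ∈ Finset.range n,
            (n.choose k : ℤ[X]) * PermPoly.T k * (PermPoly.W (n - k)).comp (X ^ 2) := by
  refine ⟨PermPoly.R_succ n, PermPoly.R_add_two n, ?_, PermPoly.T_succ n, ?_⟩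
  -- The term `k = 0` is split off; `R 1 = 1` turns it into the separate `W̃` summand.
  · rw [PermPoly.R_add_two_eq_conv_R, PermPoly.conv, Finset.range_eq_Ico,
      Finset.sum_eq_sum_Ico_succ_bot (Nat.succ_pos n), mul_add]
    simp only [Nat.choose_zero_right, Nat.cast_one, zero_add, PermPoly.R_one, one_mul, Nat.sub_zero]
    rfl
  -- The term `k = n`, where nothing stands left of the minimum, is the summand `T n`.
  · rw [PermPoly.T_succ_eq_conv_leftOfMin hn, PermPoly.conv, Finset.sum_range_succ, add_comm,
      Finset.mul_sum]
    congr 1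
    · simp [PermPoly.leftOfMin]
    · refine Finset.sum_congr rfl fun k hk => ?_
      have hk := Finset.mem_range.1 hk
      rw [PermPoly.leftOfMin, if_neg (by omega)]
      ring
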